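/- Let $n\ge 1$, let $g\in\mathfrak S_n$ be an $n$-cycle, let $\psi$ be a faithful (i.e. injective) linear character $\langle g\rangle\to\mathbb C^\times$, and let $\chi$ be the character of the complex representation of $\mathfrak S_n$ induced from $\psi$. For a composition $\lambda=(\lambda_1,\dots,\lambda_k)$ of $n$ (positive parts with sum $n$) let $\chi_\lambda$ be the value of $\chi$ on the permutations whose cycle lengths, fixed points included, are $\lambda_1,\dots,\lambda_k$ in some order, and let $S(\lambda)=\{\lambda_1,\lambda_1+\lambda_2,\dots,\lambda_1+\cdots+\lambda_k\}$. Call a word $x_1\cdots x_l$ unimodal if $x_1<\cdots<x_m>x_{m+1}>\cdots>x_l$ for some $1\le m\le l$. Let $\mathcal C(\lambda)$ be the set of permutations $\pi\in\mathfrak S_n$ that consist of a single $n$-cycle and whose one-line notation $\pi_1\pi_2\cdots\pi_n$, cut into consecutive segments of lengths $\lambda_1,\dots,\lambda_k$, has all its segments unimodal. Let $\mathrm{Des}(\pi)=\{i: 1\le i\le n-1,\ \pi_i>\pi_{i+1}\}$. Then, for every composition $\lambda$ of $n$, $$\chi_\lambda=\sum_{\pi\in\mathcal C(\lambda)}(-1)^{|\mathrm{Des}(\pi)\setminus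 S(\lambda)|}.$$ Moreover, this sum equals $(k-1)!\,d^{\,k-1}\mu(d)$ if all $k$ parts of $\lambda$ are equal to the same integer $d$, and $0$ if the parts of $\lambda$ are not all equal; here $\mu$ is the Möbius function. -/

import Mathlib

namespace UnimodalCycles

/-- A permutation of `Fin n` (with `n ≥ 1`) is cyclic if it is a single `n`-cycle, that is, a single
cycle that runs through all the points; for `n = 1` this is the identity. -/
def IsFullCycle {n : ℕ} (π : Equiv.Perm (Fin n)) : Prop :=
  π.IsCycleOn Set.univ

/-- A word `x₁ ⋯ x_l` is unimodal if it is strictly increasing up to some position `m` and strictly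
decreasing from the position `m` on. -/
def IsUnimodal {l : ℕ} {α : Type*} [Preorder α] (x : Fin l → α) : Prop :=
  ∃ m : Fin l, StrictMonoOn x (Set.Iic m) ∧ StrictAntiOn x (Set.Ici m)

/-- `π` is `c`-unimodal: each of the contiguous segments of the one-line notation of `π`, of lengths
the successive parts of the composition `c`, is unimodal. -/
def IsCompUnimodal {n : ℕ} (c : Composition n) (π : Equiv.Perm (Fin n)) : Prop :=
  ∀ i : Fin c.length, IsUnimodal fun j : Fin (c.blocksFun i) => π (c.embedding i j)

/-- The descent set `{i : 1 ≤ i ≤ n - 1, π_i > π_{i+1}}`, where the positions are numbered from `1`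
to `n`, so that `π_i` is the value of `π` at the element `i - 1` of `Fin n`. -/
def descentSet {n : ℕ} (π : Equiv.Perm (Fin n)) : Finset ℕ :=
  {i ∈ Finset.Ico 1 n | ∃ a b : Fin n, (a : ℕ) + 1 = i ∧ (b : ℕ) = i ∧ π b < π a}

/-- The set of partial sums `c₁, c₁ + c₂, …, c₁ + ⋯ + c_k` of a composition `c = (c₁, …, c_k)`. -/
def partialSums {n : ℕ} (c : Composition n) : Finset ℕ :=
  (Finset.Icc 1 c.length).image c.sizeUpTo

open Classical in
/-- The set of the `c`-unimodal cyclic permutations. -/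
noncomputable def unimodalCycles {n : ℕ} (c : Composition n) : Finset (Equiv.Perm (Fin n)) :=
  {π | IsFullCycle π ∧ IsCompUnimodal c π}

/-- The one-dimensional complex representation given by a linear character `ψ`. -/
noncomputable def linearRep {G : Type*} [Group G] (ψ : G →* ℂˣ) : Representation ℂ G ℂ where
  toFun g := (ψ g : ℂ) • LinearMap.id
  map_one' := by ext; simp
  map_mul' g h := by ext; simp [mul_comm]

/-- The character of the representation of `G` that is induced from the linear character `ψ` of the
subgroup `H`. -/
noncomputable def inducedCharacter {G : Type*} [Group G] (H : Subgroup G) (ψ : H →* ℂˣ) : G → ℂ :=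
  (Representation.ind H.subtype (linearRep ψ)).character

end UnimodalCycles

namespace UnimodalCycles
open Equiv

/-! Both sides are computed and turn out to have the same closed form. For the character, the
formula `inducedCharacter_eq` leaves only the elements of ⟨g⟩ that are conjugate to τ. An element of
order d in ⟨g⟩ has n/d cycles of length d, so τ must have equal cycle lengths d, and a faithful ψ
sums to μ(d) over the elements of order d (`sum_faithful_orderOf`).

For the signed sum, the sign of a unimodal segment plays the role of a power sum p_m and the
indicator of an increasing segment that of a complete symmetric function h_m: they satisfy Newton's
identity word by word (`sum_unimodalSign_mul_runIndicator`). It thus suffices to count the full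
cycles that increase on prescribed blocks. A bijection of Gessel–Reutenauer type turns them into
primitive cyclic words of given content (`card_labelings_eq_card_words`), and Möbius inversion gives
n · count = ∑ μ(d) (n/d)! ∏ 1/(λ_i/d)!, over the d that divide n and all λ_i. For each d this
product is h_λ specialized at p_d = d and p_m = 0 for m ≠ d. Passing back from h to p
(`sum_wordWeight`) replaces it by ∏ d·[λ_i = d], which vanishes unless all parts equal d. -/

/-! ### The induced character. -/

open Representation in
/-- The trace of an endomorphism that a linear map of the underlying space of a representation of a
finite group induces on the coinvariants. -/
theorem trace_coinvariants {k G V : Type*} [Field k] [Group G] [Fintype G] [AddCommGroup V]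
    [Module k V] [FiniteDimensional k V] (ρ : Representation k G V) (hG : (Fintype.card G : k) ≠ 0)
    (T : V →ₗ[k] V) (T' : Coinvariants ρ →ₗ[k] Coinvariants ρ)
    (h : T' ∘ₗ Coinvariants.mk ρ = Coinvariants.mk ρ ∘ₗ T) :
    LinearMap.trace k _ T' =
      (Fintype.card G : k)⁻¹ * ∑ g : G, LinearMap.trace k V (T ∘ₗ ρ g) := by
  -- Averaging over the group is a section of the projection `Coinvariants.mk ρ`; cyclicity of the
  -- trace then moves the computation to `V`.
  let s : Coinvariants ρ →ₗ[k] V :=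
    Coinvariants.lift ρ ((Fintype.card G : k)⁻¹ • ∑ g : G, ρ g) (by
      intro x
      rw [LinearMap.smul_comp]
      congr 1
      ext v
      simp only [LinearMap.comp_apply, LinearMap.sum_apply]
      refine Fintype.sum_equiv (Equiv.mulRight x) _ _ fun g => ?_
      simp)
  have hs : Coinvariants.mk ρ ∘ₗ s = LinearMap.id := by
    apply Coinvariants.hom_ext
    ext v
    simp [s, ← Nat.cast_smul_eq_nsmul k, smul_smul, hG]
  have h1 : T' = Coinvariants.mk ρ ∘ₗ (T ∘ₗ s) := by
    rw [← LinearMap.comp_assoc, ← h, LinearMap.comp_assoc, hs, LinearMap.comp_id]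
  rw [h1, LinearMap.trace_comp_comm', LinearMap.comp_assoc, Coinvariants.lift_comp_mk,
    LinearMap.comp_smul, map_smul, smul_eq_mul]
  congr 1
  rw [← map_sum (LinearMap.trace k V) (fun g => T ∘ₗ ρ g)]
  congr 1
  refine LinearMap.ext fun v => ?_
  simp

theorem trace_of_map_basis {k V X : Type*} [Field k] [AddCommGroup V] [Module k V] [Fintype X]
    [DecidableEq X] (b : Module.Basis X k V) (T : V →ₗ[k] V) (f : X → X)
    (h : ∀ x, T (b x) = b (f x)) :
    LinearMap.trace k V T = (Finset.univ.filter fun x => f x = x).card := by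
  rw [LinearMap.trace_eq_matrix_trace k b, Matrix.trace]
  simp [LinearMap.toMatrix_apply, Finsupp.single_apply, h]

/-- The induced space is the coinvariants of `H` on `ℂ[G] ⊗ ℂ`, where `τ` acts through `x ↦ x *
τ⁻¹`. The trace of a map that permutes the basis `G` counts the fixed points, here the solutions of
`h * x * τ⁻¹ = x`. -/
theorem inducedCharacter_eq {G : Type*} [Group G] [Fintype G] [DecidableEq G] (H : Subgroup G)
    [Fintype H] (ψ : H →* ℂˣ) (τ : G) :
    inducedCharacter H ψ τ = (Fintype.card H : ℂ)⁻¹ *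
      ∑ h : H, (ψ h : ℂ) * (Finset.univ.filter fun x : G => (h : G) * x = x * τ).card := by
  let b : Module.Basis G ℂ (MonoidAlgebra ℂ G) := .ofRepr (MonoidAlgebra.coeffLinearEquiv ℂ)
  have hb : ∀ x, b x = MonoidAlgebra.single x 1 := fun x => rfl
  have : Module.Finite ℂ (MonoidAlgebra ℂ G) := .of_basis b
  unfold inducedCharacter Representation.character
  rw [trace_coinvariants (Representation.tprod
      ((Representation.leftRegular ℂ G).comp H.subtype) (linearRep ψ)) (by simp)
    (T := (MonoidAlgebra.mapDomainLinearMap ℂ ℂ fun x => x * τ⁻¹).rTensor _)]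
  · congr 1
    refine Finset.sum_congr rfl fun h _ => ?_
    rw [Representation.tprod_apply, LinearMap.rTensor_comp_map, LinearMap.trace_tensorProduct',
      trace_of_map_basis b _ (fun x => h * x * τ⁻¹), mul_comm]
    · simp only [mul_inv_eq_iff_eq_mul]
      congr 1
      simp [linearRep]
    · intro x
      simp [hb]
  · rfl

theorem IsFullCycle.zpow_apply_eq_self {n : ℕ} {g : Perm (Fin n)} (hg : IsFullCycle g) {j : ℤ}
    (a : Fin n) : (g ^ j) a = a ↔ (n : ℤ) ∣ j := by
  have h : g.IsCycleOn ((Finset.univ : Finset (Fin n)) : Set (Fin n)) := by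
    rw [Finset.coe_univ]; exact hg
  simpa using h.zpow_apply_eq (Finset.mem_univ a) (n := j)

theorem IsFullCycle.orderOf_eq {n : ℕ} (hn : 1 ≤ n) {g : Perm (Fin n)} (hg : IsFullCycle g) :
    orderOf g = n := by
  apply Nat.dvd_antisymm
  · rw [orderOf_dvd_iff_pow_eq_one]
    ext a
    have := (hg.zpow_apply_eq_self (j := n) a).2 dvd_rfl
    simpa using congrArg Fin.val this
  · have := (hg.zpow_apply_eq_self (j := orderOf g) ⟨0, hn⟩).1 (by simp [pow_orderOf_eq_one])
    exact_mod_cast this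

theorem IsFullCycle.eq_one_of_apply_eq {n : ℕ} {g h : Perm (Fin n)} (hg : IsFullCycle g)
    (hh : h ∈ Subgroup.zpowers g) {a : Fin n} (ha : h a = a) : h = 1 := by
  obtain ⟨j, rfl⟩ := hh
  have hd := (hg.zpow_apply_eq_self a).1 ha
  ext b
  exact congrArg Fin.val ((hg.zpow_apply_eq_self b).2 hd)

/-- A power of a full cycle with a fixed point is trivial. If `h` has a cycle of length `m`, then `h
^ m` fixes a point, so `h ^ m = 1` and `m` is the order of `h`. -/
theorem IsFullCycle.partition_parts {n : ℕ} {g h : Perm (Fin n)} (hg : IsFullCycle g)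
    (hh : h ∈ Subgroup.zpowers g) :
    h.partition.parts = Multiset.replicate (n / orderOf h) (orderOf h) := by
  by_cases h1 : h = 1
  · subst h1
    simp [Perm.parts_partition]
  have hsupp : h.support = Finset.univ := by
    ext a
    simp only [Perm.mem_support, Finset.mem_univ, iff_true]
    exact fun ha => h1 (hg.eq_one_of_apply_eq hh ha)
  have hall : ∀ m ∈ h.cycleType, m = orderOf h := by
    intro m hm
    apply Nat.dvd_antisymm (Perm.dvd_of_mem_cycleType hm)
    obtain ⟨c, τ, hc, hdis, hcyc, hcard⟩ := Perm.mem_cycleType_iff.1 hm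
    rw [orderOf_dvd_iff_pow_eq_one]
    obtain ⟨a, ha⟩ := hcyc.nonempty_support
    refine hg.eq_one_of_apply_eq (Subgroup.pow_mem _ hh m) (a := a) ?_
    have hτ : τ a = a := by
      rcases hdis a with h' | h'
      · exact absurd h' (Perm.mem_support.1 ha)
      · exact h'
    rw [hc, hdis.commute.mul_pow, Perm.mul_apply, Perm.pow_apply_eq_self_of_apply_eq_self hτ, ← hcard,
      ← hcyc.orderOf, pow_orderOf_eq_one, Perm.one_apply]
  have hrep := Multiset.eq_replicate_card.2 hall
  have hsum : h.cycleType.sum = n := by rw [Perm.sum_cycleType, hsupp]; simp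
  rw [Perm.parts_partition, hsupp]
  simp only [Finset.card_univ, Fintype.card_fin, Nat.sub_self, Multiset.replicate_zero, add_zero]
  rw [hrep, Multiset.sum_replicate, smul_eq_mul] at hsum
  rw [hrep]
  congr 1
  exact Nat.eq_div_of_mul_eq_left (orderOf_pos h).ne' hsum

/-- The conjugators from `τ` to `h` form a coset of the centralizer of `τ`. -/
theorem card_conjugators {G : Type*} [Group G] [Fintype G] [DecidableEq G] (h τ : G)
    (hc : IsConj τ h) :
    (Finset.univ.filter fun x : G => h * x = x * τ).card =
      Nat.card (Subgroup.centralizer {τ}) := by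
  obtain ⟨y, hy⟩ := isConj_iff.1 hc
  rw [← Fintype.card_subtype, ← Nat.card_eq_fintype_card]
  refine Nat.card_congr ((Equiv.mulLeft y⁻¹).subtypeEquiv fun x => ?_)
  rw [Subgroup.mem_centralizer_singleton_iff, ← hy]
  simp only [Equiv.coe_mulLeft]
  constructor <;> intro h'
  · have : y * (y⁻¹ * x * τ) = y * (τ * (y⁻¹ * x)) := by simpa [mul_assoc] using h'.symm
    exact mul_left_cancel this
  · simpa [mul_assoc] using congrArg (y * ·) h'.symm

theorem card_centralizer_of_parts {n d k : ℕ} (τ : Perm (Fin n)) (hd : 0 < d)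
    (h : τ.partition.parts = Multiset.replicate k d) :
    Nat.card (Subgroup.centralizer {τ}) = d ^ k * k.factorial := by
  have hsum : k * d = n := by
    have := τ.partition.parts_sum
    rw [h] at this
    simpa using this
  have hf := Perm.filter_parts_partition_eq_cycleType (σ := τ)
  rw [h] at hf
  rw [Perm.nat_card_centralizer, ← hf]
  rcases Nat.lt_or_ge d 2 with h2 | h2
  · obtain rfl : d = 1 := by omega
    rw [Multiset.filter_eq_nil.2]
    · simp; rw [← hsum, mul_one]
    · intro a ha
      rw [Multiset.eq_of_mem_replicate ha]
      omega
  · rw [Multiset.filter_eq_self.2]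
    · rcases Nat.eq_zero_or_pos k with rfl | hk
      · simp at hsum
        subst hsum; simp
      · simp [hsum, Multiset.toFinset_replicate, hk.ne']
    · intro a ha
      rw [Multiset.eq_of_mem_replicate ha]
      omega

theorem sum_moebius_divisors {n : ℕ} : ∑ d ∈ n.divisors, ArithmeticFunction.moebius d =
    if n = 1 then 1 else 0 := by
  rw [← ArithmeticFunction.coe_mul_zeta_apply, ArithmeticFunction.moebius_mul_coe_zeta,
    ArithmeticFunction.one_apply]

/-- The values of a faithful linear character of a cyclic group at the elements of order `d` add up
to `μ d`. -/
theorem sum_faithful_orderOf {G : Type*} [Group G] [Fintype G] [DecidableEq G] [IsCyclic G]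
    (ψ : G →* ℂˣ) (hψ : Function.Injective ψ) {d : ℕ} (hd : d ∣ Fintype.card G) :
    ∑ h : G with orderOf h = d, (ψ h : ℂ) = ArithmeticFunction.moebius d := by
  -- By Möbius inversion it is enough that the values of `ψ` on the solutions of `h ^ m = 1` sum to
  -- 1 for `m = 1` and to 0 for the other divisors.
  have key := (ArithmeticFunction.sum_eq_iff_sum_mul_moebius_eq_on
    (f := fun d => ∑ h : G with orderOf h = d, (ψ h : ℂ))
    (g := fun d => if d = 1 then (1 : ℂ) else 0) {d | d ∣ Fintype.card G}
    (fun m n hmn hn => hmn.trans hn)).1 ?_ d (Nat.pos_of_dvd_of_pos hd Fintype.card_pos) hd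
  · rw [← key]
    rw [Finset.sum_eq_single (d, 1)]
    · simp
    · rintro ⟨a, b⟩ hab hne
      rw [Nat.mem_divisorsAntidiagonal] at hab
      rw [if_neg, mul_zero]
      rintro rfl
      apply hne
      simp_all
    · intro h
      exfalso
      apply h
      rw [Nat.mem_divisorsAntidiagonal]
      exact ⟨by simp, (Nat.pos_of_dvd_of_pos hd Fintype.card_pos).ne'⟩
  · intro m hm hmd
    have hfib : ∑ i ∈ m.divisors, ∑ h : G with orderOf h = i, (ψ h : ℂ) =
        ∑ h : G with h ^ m = 1, (ψ h : ℂ) := by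
      refine Eq.trans ?_ (Finset.sum_fiberwise_of_maps_to (s := Finset.univ.filter fun h : G => h ^ m = 1)
        (g := fun h : G => orderOf h) (t := m.divisors) ?_ _)
      · refine Finset.sum_congr rfl fun i hi => Finset.sum_congr ?_ fun _ _ => rfl
        ext h
        simp only [Finset.mem_filter, Finset.mem_univ, true_and, iff_and_self]
        rintro rfl
        exact orderOf_dvd_iff_pow_eq_one.1 (Nat.dvd_of_mem_divisors hi)
      · intro h hh
        rw [Nat.mem_divisors]
        exact ⟨orderOf_dvd_iff_pow_eq_one.2 (Finset.mem_filter.1 hh).2, hm.ne'⟩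
    rw [hfib]
    split_ifs with h1
    · subst h1
      simp [Finset.filter_eq']
    · obtain ⟨g, hg⟩ := IsCyclic.exists_ofOrder_eq_natCard (α := G)
      rw [Nat.card_eq_fintype_card] at hg
      obtain ⟨h0, hh0⟩ : ∃ h0 : G, orderOf h0 = m := by
        obtain ⟨c, hc⟩ := hmd
        refine ⟨g ^ c, ?_⟩
        have hc0 : c ≠ 0 := by rintro rfl; simp at hc
        rw [orderOf_pow_of_dvd hc0 (by rw [hg, hc]; exact Dvd.intro_left m rfl), hg, hc,
          Nat.mul_div_cancel _ (Nat.pos_of_ne_zero hc0)]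
      have hne : (ψ h0 : ℂ) ≠ 1 := by
        intro h
        rw [Units.val_eq_one, map_eq_one_iff ψ hψ] at h
        rw [h, orderOf_one] at hh0
        exact h1 hh0.symm
      -- Multiplication by `h0` permutes the solutions, so the sum is invariant under the factor `ψ
      -- h0 ≠ 1`.
      have hmul : (ψ h0 : ℂ) * ∑ h : G with h ^ m = 1, (ψ h : ℂ) =
          ∑ h : G with h ^ m = 1, (ψ h : ℂ) := by
        rw [Finset.mul_sum]
        refine Finset.sum_equiv (Equiv.mulLeft h0) (fun h => ?_) (fun h _ => by simp)
        have hcomm : Commute h0 h := by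
          let _ := IsCyclic.commGroup (α := G)
          exact mul_comm h0 h
        simp [hcomm.mul_pow, ← hh0, pow_orderOf_eq_one]
      by_contra h
      exact hne (mul_right_cancel₀ h (by rw [hmul, one_mul]))

/-- Only the elements of order `d` contribute, each with the centralizer order `d ^ k * k!`; the
division by `n = k * d` leaves the stated value. -/
theorem inducedCharacter_of_replicate {n : ℕ} (hn : 1 ≤ n) {g : Perm (Fin n)} (hg : IsFullCycle g)
    (ψ : Subgroup.zpowers g →* ℂˣ) (hψ : Function.Injective ψ) {d k : ℕ} (τ : Perm (Fin n))
    (hτ : τ.partition.parts = Multiset.replicate k d) :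
    inducedCharacter (Subgroup.zpowers g) ψ τ =
      (k - 1).factorial * (d : ℂ) ^ (k - 1) * ArithmeticFunction.moebius d := by
  have hsum : k * d = n := by
    have := τ.partition.parts_sum
    rw [hτ] at this
    simpa using this
  have hd : 0 < d := Nat.pos_of_ne_zero (by rintro rfl; omega)
  have hk : 0 < k := Nat.pos_of_ne_zero (by rintro rfl; omega)
  classical
  have hcard : Fintype.card (Subgroup.zpowers g) = n := by
    rw [Fintype.card_zpowers, hg.orderOf_eq hn]
  rw [inducedCharacter_eq, hcard]
  have hterm : ∀ h : Subgroup.zpowers g,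
      (ψ h : ℂ) * (Finset.univ.filter fun x : Perm (Fin n) => (h : Perm (Fin n)) * x = x * τ).card =
      if orderOf h = d then (ψ h : ℂ) * (d ^ k * k.factorial) else 0 := by
    intro h
    have hp := IsFullCycle.partition_parts hg h.2
    split_ifs with ho
    · rw [card_conjugators, card_centralizer_of_parts τ hd hτ]
      · push_cast; rfl
      · rw [Perm.partition_eq_of_isConj, Nat.Partition.ext_iff, hτ, hp, Subgroup.orderOf_coe, ho,
          ← hsum, Nat.mul_div_cancel _ hd]
    · rw [Finset.filter_false_of_mem]
      · simp
      · intro x _ hx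
        have hc : IsConj τ h := isConj_iff.2 ⟨x, by rw [← hx]; simp⟩
        rw [Perm.partition_eq_of_isConj, Nat.Partition.ext_iff, hτ, hp, Subgroup.orderOf_coe] at hc
        have : d ∈ Multiset.replicate k d := Multiset.mem_replicate.2 ⟨hk.ne', rfl⟩
        rw [hc] at this
        exact ho (Multiset.eq_of_mem_replicate this).symm
  simp only [hterm]
  rw [← Finset.sum_filter, ← Finset.sum_mul, sum_faithful_orderOf ψ hψ (by
    rw [hcard]; exact Dvd.intro_left k hsum), ← hsum]
  obtain ⟨k, rfl⟩ := Nat.exists_eq_succ_of_ne_zero hk.ne'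
  have hd' : (d : ℂ) ≠ 0 := by exact_mod_cast hd.ne'
  have hk' : (k : ℂ) + 1 ≠ 0 := by exact_mod_cast k.succ_ne_zero
  simp only [Nat.succ_eq_add_one, Nat.add_sub_cancel, Nat.factorial_succ]
  push_cast
  field_simp
  ring

theorem inducedCharacter_of_ne {n : ℕ} {g : Perm (Fin n)} (hg : IsFullCycle g)
    (ψ : Subgroup.zpowers g →* ℂˣ) (τ : Perm (Fin n))
    (hτ : ∀ k d, τ.partition.parts ≠ Multiset.replicate k d) :
    inducedCharacter (Subgroup.zpowers g) ψ τ = 0 := by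
  classical
  rw [inducedCharacter_eq, Finset.sum_eq_zero, mul_zero]
  intro h _
  rw [Finset.filter_false_of_mem]
  · simp
  · intro x _ hx
    have hc : IsConj τ h := isConj_iff.2 ⟨x, by rw [← hx]; simp⟩
    rw [Perm.partition_eq_of_isConj, Nat.Partition.ext_iff, IsFullCycle.partition_parts hg h.2] at hc
    exact hτ _ _ hc

/-! ### Full cycles that increase on blocks, and primitive cyclic words. -/

/-- `π` is increasing on each of the fibres of `b`. -/
def IsIncreasingOnFibers {n : ℕ} {κ : Type*} (b : Fin n → κ) (π : Perm (Fin n)) : Prop :=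
  ∀ i j, i < j → b i = b j → π i < π j

theorem isFullCycle_permCongr {n : ℕ} [NeZero n] (e : ZMod n ≃ Fin n) :
    IsFullCycle (e.permCongr (Equiv.addRight 1)) := by
  refine ⟨Set.bijOn_univ.2 (Equiv.bijective _), fun x _ y _ => ⟨((e.symm y - e.symm x).val : ℤ), ?_⟩⟩
  have h : ∀ m : ℕ, (e.permCongr (Equiv.addRight 1) ^ m) x = e (e.symm x + m) := by
    intro m
    induction m with
    | zero => simp
    | succ m ih => rw [pow_succ', Perm.mul_apply, ih]; simp [add_assoc]
  rw [zpow_natCast, h]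
  simp

theorem exists_permCongr_eq {n : ℕ} [NeZero n] {π : Perm (Fin n)} (hπ : IsFullCycle π) (a : Fin n) :
    ∃ e : ZMod n ≃ Fin n, e.permCongr (Equiv.addRight 1) = π ∧ e 0 = a := by
  have hc : π.IsCycleOn ((Finset.univ : Finset (Fin n)) : Set (Fin n)) := by
    rw [Finset.coe_univ]; exact hπ
  have hmod : ∀ x y : ℕ, (π ^ x) a = (π ^ y) a ↔ (x : ZMod n) = y := by
    intro x y
    rw [hc.pow_apply_eq_pow_apply (Finset.mem_univ a), Finset.card_univ, Fintype.card_fin,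
      ZMod.natCast_eq_natCast_iff]
  have hinj : Function.Injective fun i : ZMod n => (π ^ i.val) a := by
    intro i j hij
    simpa using (hmod _ _).1 hij
  have hbij := (Fintype.bijective_iff_injective_and_card _).2 ⟨hinj, by simp [ZMod.card]⟩
  have happ : ∀ i : ZMod n, π ((π ^ i.val) a) = (π ^ (i + 1).val) a := by
    intro i
    rw [← Perm.mul_apply, ← pow_succ', hmod]
    simp
  refine ⟨Equiv.ofBijective _ hbij, ?_, by simp⟩
  ext x
  obtain ⟨i, rfl⟩ := (Equiv.ofBijective _ hbij).surjective x
  rw [Equiv.permCongr_apply, Equiv.symm_apply_apply, Equiv.ofBijective_apply,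
    Equiv.ofBijective_apply, happ]
  simp

/-- A full cycle is read off from exactly `n` labelings `e` with `π (e i) = e (i + 1)`, one for each
starting point `e 0`. -/
theorem card_mul_card_fullCycles {n : ℕ} [NeZero n] (P : Perm (Fin n) → Prop) [DecidablePred P]
    [DecidablePred fun π : Perm (Fin n) => IsFullCycle π ∧ P π] :
    n * (Finset.univ.filter fun π : Perm (Fin n) => IsFullCycle π ∧ P π).card =
      (Finset.univ.filter fun e : ZMod n ≃ Fin n => P (e.permCongr (Equiv.addRight 1))).card := by
  rw [Finset.card_eq_sum_card_fiberwise (f := fun e : ZMod n ≃ Fin n => e.permCongr (Equiv.addRight 1))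
    (t := Finset.univ.filter fun π : Perm (Fin n) => IsFullCycle π ∧ P π), mul_comm]
  · refine (Finset.sum_const_nat fun π hπ => ?_).symm
    obtain ⟨hcyc, hP⟩ := (Finset.mem_filter.1 hπ).2
    conv_rhs => rw [← Fintype.card_fin n, ← Finset.card_univ]
    refine Finset.card_bij (fun e _ => e 0) (fun _ _ => Finset.mem_univ _) ?_ ?_
    · intro e he e' he' h0
      have h1 := (Finset.mem_filter.1 he).2
      have h2 := (Finset.mem_filter.1 he').2
      have hnat : ∀ m : ℕ, e m = e' m := by
        intro m
        induction m with
        | zero => simpa using h0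
        | succ m ih =>
          have a1 := congrArg (fun σ : Perm (Fin n) => σ (e m)) h1
          have a2 := congrArg (fun σ : Perm (Fin n) => σ (e' m)) h2
          simp only [Equiv.permCongr_apply, Equiv.symm_apply_apply, Equiv.coe_addRight] at a1 a2
          rw [Nat.cast_succ, a1, a2, ih]
      ext i
      have := hnat i.val
      simp only [ZMod.natCast_val, ZMod.cast_id', id] at this
      rw [this]
    · intro a _
      obtain ⟨e, he, h0⟩ := exists_permCongr_eq hcyc a
      refine ⟨e, ?_, h0⟩
      simp [he, hP]
  · intro e he
    simp only [Finset.coe_filter, Finset.mem_univ, true_and, Set.mem_ofPred_eq] at he ⊢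
    exact ⟨isFullCycle_permCongr e, he⟩

theorem isIncreasingOnFibers_permCongr {n : ℕ} {κ : Type*} (b : Fin n → κ) (e : ZMod n ≃ Fin n) :
    IsIncreasingOnFibers b (e.permCongr (Equiv.addRight 1)) ↔
      ∀ i j, e i < e j → b (e i) = b (e j) → e (i + 1) < e (j + 1) := by
  constructor
  · intro h i j hij hb
    simpa using h _ _ hij hb
  · intro h i j hij hb
    simpa using h (e.symm i) (e.symm j) (by simpa using hij) (by simpa using hb)

/-- A strict order relation on the points of a cycle cannot hold between each point and its
translate. -/
theorem not_lt_translate {n : ℕ} [NeZero n] (e : ZMod n → Fin n) (i s : ZMod n)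
    (h : ∀ t : ℕ, e (i + t) < e (i + s + t)) : False := by
  have hm : ∀ m : ℕ, e i < e (i + (m + 1 : ℕ) * s) := by
    intro m
    induction m with
    | zero => simpa using h 0
    | succ m ih =>
      refine ih.trans ?_
      have := h ((((m + 1 : ℕ) : ZMod n) * s).val)
      simp only [ZMod.natCast_val, ZMod.cast_id', id] at this
      have heq : i + ((m + 1 + 1 : ℕ) : ZMod n) * s = i + s + ((m + 1 : ℕ) : ZMod n) * s := by
        push_cast; ring
      rwa [heq]
  have := hm (n - 1)
  rw [Nat.sub_add_cancel (NeZero.one_le)] at this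
  simp at this

/-- The bijection sends `e` to the word `b ∘ e`. Conversely, `e` must rank the positions by the
lexicographic order of the translates of the word read from them: a tie between letters is decided
by the next positions. Primitivity makes the translates distinct. -/
theorem card_labelings_eq_card_words {n : ℕ} [NeZero n] {κ : Type*} [LinearOrder κ] [Fintype κ]
    (b : Fin n → κ) (hb : Monotone b)
    [DecidablePred (IsIncreasingOnFibers b)]
    [DecidablePred fun w : ZMod n → κ => (∃ e : ZMod n ≃ Fin n, w = b ∘ e) ∧
        ∀ d : ZMod n, (∀ i, w (i + d) = w i) → d = 0] :
    (Finset.univ.filter fun e : ZMod n ≃ Fin n =>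
        IsIncreasingOnFibers b (e.permCongr (Equiv.addRight 1))).card =
      (Finset.univ.filter fun w : ZMod n → κ => (∃ e : ZMod n ≃ Fin n, w = b ∘ e) ∧
        ∀ d : ZMod n, (∀ i, w (i + d) = w i) → d = 0).card := by
  have hstep : ∀ e e' : ZMod n ≃ Fin n, IsIncreasingOnFibers b (e.permCongr (Equiv.addRight 1)) →
      IsIncreasingOnFibers b (e'.permCongr (Equiv.addRight 1)) → b ∘ e = b ∘ e' →
      ∀ i j, e i < e j → e' i < e' j := by
    intro e e' he he' hee i j hij
    rw [isIncreasingOnFibers_permCongr] at he he'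
    by_contra hlt
    have hne : i ≠ j := fun h => hij.ne (by rw [h])
    have hgt : e' j < e' i := lt_of_le_of_ne (not_lt.1 hlt) fun h => hne (e'.injective h.symm)
    have hw : ∀ k, b (e k) = b (e' k) := fun k => congrFun hee k
    -- If `e` and `e'` order `i` and `j` oppositely, monotonicity of `b` forces equal letters there,
    -- so the disagreement passes to `i + 1` and `j + 1`, and on around the cycle.
    have hall : ∀ t : ℕ, e (i + t) < e (j + t) ∧ e' (j + t) < e' (i + t) := by
      intro t
      induction t with
      | zero => simpa using ⟨hij, hgt⟩
      | succ t ih =>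
        have h1 := hb ih.1.le
        have h2 := hb ih.2.le
        rw [← hw, ← hw] at h2
        have h3 := le_antisymm h1 h2
        have h4 := he _ _ ih.1 h3
        have h5 := he' _ _ ih.2 (by rw [← hw, ← hw, h3])
        push_cast
        rw [← add_assoc, ← add_assoc]
        exact ⟨h4, h5⟩
    exact not_lt_translate e i (j - i) fun t => by simpa using (hall t).1
  refine Finset.card_bij (fun e _ => b ∘ e) ?_ ?_ ?_
  · intro e he
    have he := (Finset.mem_filter.1 he).2
    rw [isIncreasingOnFibers_permCongr] at he
    refine Finset.mem_filter.2 ⟨Finset.mem_univ _, ⟨e, rfl⟩, fun d hd => ?_⟩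
    have hd : ∀ i, b (e (i + d)) = b (e i) := hd
    by_contra hd0
    -- With a nonzero period `d`, the letters at `t` and `d + t` always tie, so the comparison of `e
    -- d` with `e 0` persists under all translations.
    rcases lt_or_gt_of_ne (fun h => hd0 (by simpa using e.injective h) : e (0 + d) ≠ e 0) with h | h
    · have hall : ∀ t : ℕ, e (d + t) < e (t : ZMod n) := by
        intro t
        induction t with
        | zero => simpa using h
        | succ t ih =>
          have := he _ _ ih (by rw [add_comm, hd])
          push_cast
          rwa [← add_assoc]
      refine not_lt_translate e d (-d) fun t => ?_
      simpa using hall t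
    · have hall : ∀ t : ℕ, e (t : ZMod n) < e (d + t) := by
        intro t
        induction t with
        | zero => simpa using h
        | succ t ih =>
          have := he _ _ ih (by rw [add_comm d, hd])
          push_cast
          rwa [← add_assoc]
      refine not_lt_translate e 0 d fun t => ?_
      simpa using hall t
  · intro e he e' he' hee
    have he := (Finset.mem_filter.1 he).2
    have he' := (Finset.mem_filter.1 he').2
    have hmono : StrictMono (e.symm.trans e') := by
      intro x y hxy
      exact hstep e e' he he' hee _ _ (by simpa using hxy)
    have hid : (e.symm.trans e') = Equiv.refl _ := by
      have := Subsingleton.elim (StrictMono.orderIsoOfSurjective _ hmono (Equiv.surjective _))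
        (OrderIso.refl (Fin n))
      ext x
      have h := congrArg (fun f : Fin n ≃o Fin n => f x) this
      simpa using congrArg Fin.val h
    ext i
    have := congrArg (fun σ : Perm (Fin n) => σ (e i)) hid
    simpa using congrArg Fin.val this.symm
  · intro w hw
    obtain ⟨⟨e₀, he₀⟩, hprim⟩ := (Finset.mem_filter.1 hw).2
    let key : ZMod n → Lex (ℕ → κ) := fun i => toLex fun t => w (i + t)
    have hkey : Function.Injective key := by
      intro i j hij
      have h1 : ∀ t : ℕ, w (i + t) = w (j + t) := fun t => congrFun hij t
      have := hprim (j - i) fun k => by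
        have := h1 (k - i).val
        simp only [ZMod.natCast_val, ZMod.cast_id', id] at this
        rw [add_sub_cancel] at this
        rw [this]
        congr 1; ring
      exact (sub_eq_zero.1 this).symm
    have hstep : ∀ i j, key i < key j → w i < w j ∨ (w i = w j ∧ key (i + 1) < key (j + 1)) := by
      rintro i j ⟨t, ht, hlt⟩
      rcases t with _ | t
      · left
        simpa [key] using hlt
      · right
        refine ⟨by simpa [key] using ht 0 (Nat.succ_pos t), t, fun s hs => ?_, ?_⟩
        · simpa [key, add_assoc, add_comm (1 : ZMod n)] using ht (s + 1) (Nat.succ_lt_succ hs)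
        · simpa [key, add_assoc, add_comm (1 : ZMod n)] using hlt
    classical
    let φ : Fin n ≃o Set.range key := Fintype.orderIsoFinOfCardEq _ (by
      rw [Set.card_range_of_injective hkey, ZMod.card])
    let e : ZMod n ≃ Fin n := (Equiv.ofInjective key hkey).trans φ.symm.toEquiv
    have he : ∀ i j, e i < e j ↔ key i < key j := by
      intro i j
      simp only [e, Equiv.trans_apply]
      exact φ.symm.lt_iff_lt
    have hwb : w = b ∘ e := by
      have hm : Monotone (w ∘ e.symm) := by
        intro x y hxy
        rcases hxy.lt_or_eq with h | h
        · have := (he (e.symm x) (e.symm y)).1 (by simpa using h)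
          rcases hstep _ _ this with h' | h'
          · exact h'.le
          · exact h'.1.le
        · rw [h]
      -- `w ∘ e.symm` and `b` are monotone rearrangements of the same word, hence equal.
      have := Tuple.unique_monotone (f := b) (σ := e.symm.trans e₀) (τ := Equiv.refl _)
        (by simpa [he₀, Function.comp_def] using hm) (by simpa using hb)
      rw [he₀]
      ext i
      simpa using congrFun this (e i)
    refine ⟨e, Finset.mem_filter.2 ⟨Finset.mem_univ _, ?_⟩, hwb.symm⟩
    rw [isIncreasingOnFibers_permCongr]
    intro i j hij hbij
    rw [he] at hij ⊢
    rcases hstep _ _ hij with h | h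
    · rw [hwb] at h
      exact absurd hbij h.ne
    · exact h.2

/-! ### Counting words by content and period. -/

theorem iterate_translate {n : ℕ} {κ : Type*} (w : ZMod n → κ) (m : ℕ) :
    (fun (w : ZMod n → κ) i => w (i + 1))^[m] w = fun i => w (i + m) := by
  induction m with
  | zero => simp
  | succ m ih =>
    rw [Function.iterate_succ_apply', ih]
    ext i
    rw [Nat.cast_succ, add_comm (m : ZMod n), ← add_assoc]

/-- Möbius inversion over the periods of a cyclic word detects whether the word is primitive. -/
theorem sum_moebius_periods {n : ℕ} [NeZero n] {κ : Type*} (w : ZMod n → κ)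
    [∀ d : ℕ, Decidable (∀ i, w (i + (n / d : ℕ)) = w i)]
    [Decidable (∀ d : ZMod n, (∀ i, w (i + d) = w i) → d = 0)] :
    (∑ d ∈ n.divisors, if ∀ i, w (i + (n / d : ℕ)) = w i then ArithmeticFunction.moebius d else 0) =
      if ∀ d : ZMod n, (∀ i, w (i + d) = w i) → d = 0 then 1 else 0 := by
  set p := Function.minimalPeriod (fun (w : ZMod n → κ) i => w (i + 1)) w with hp
  have hper : ∀ m : ℕ, (∀ i, w (i + m) = w i) ↔ p ∣ m := by
    intro m
    rw [hp, ← Function.isPeriodicPt_iff_minimalPeriod_dvd, Function.IsPeriodicPt,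
      Function.IsFixedPt, iterate_translate, funext_iff]
  have hpn : p ∣ n := (hper n).1 (by simp)
  obtain ⟨q, hq⟩ := hpn
  have hn := NeZero.ne n
  have hp0 : 0 < p := Nat.pos_of_ne_zero (by rintro h; simp [h] at hq; exact hn hq)
  have hq0 : q ≠ 0 := by rintro rfl; simp at hq; exact hn hq
  -- With `n = p * q`, the number `n / d` is a period exactly when `d ∣ q`, so the sum is that of
  -- `μ` over the divisors of `q`; primitivity means `q = 1`.
  have hdvd : ∀ d ∈ n.divisors, ((∀ i, w (i + (n / d : ℕ)) = w i) ↔ d ∣ q) := by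
    intro d hd
    rw [hper]
    obtain ⟨c, hc⟩ := Nat.dvd_of_mem_divisors hd
    have hd0 : 0 < d := Nat.pos_of_mem_divisors hd
    rw [Nat.div_eq_of_eq_mul_right hd0 hc]
    constructor
    · rintro ⟨x, rfl⟩
      refine ⟨x, Nat.eq_of_mul_eq_mul_left hp0 ?_⟩
      rw [← hq, hc]; ring
    · rintro ⟨x, rfl⟩
      refine ⟨x, Nat.eq_of_mul_eq_mul_left hd0 ?_⟩
      rw [← hc, hq]; ring
  rw [← Finset.sum_filter, Finset.filter_congr hdvd,
    show (n.divisors.filter fun d => d ∣ q) = q.divisors by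
      ext d
      simp only [Finset.mem_filter, Nat.mem_divisors]
      exact ⟨fun h => ⟨h.2, hq0⟩, fun h => ⟨⟨h.1.trans (hq ▸ Dvd.intro_left p rfl), hn⟩, h.1⟩⟩,
    sum_moebius_divisors]
  congr 1
  rw [eq_iff_iff]
  constructor
  · rintro rfl d hd
    have := (hper d.val).1 (by simpa using hd)
    rw [mul_one] at hq
    rw [← hq] at this
    have := Nat.eq_zero_of_dvd_of_lt this (ZMod.val_lt d)
    simpa using this
  · intro h
    have h1 := h p ((hper p).2 dvd_rfl)
    rw [ZMod.natCast_eq_zero_iff] at h1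
    have h2 : n = p := Nat.dvd_antisymm h1 ⟨q, hq⟩
    rw [← h2] at hq
    exact Nat.eq_of_mul_eq_mul_left (Nat.pos_of_ne_zero hn) (by rw [← hq, mul_one])

theorem exists_eq_comp_equiv_iff {X Y κ : Type*} [Fintype X] [Fintype Y] [DecidableEq κ]
    (w : X → κ) (b : Y → κ) :
    (∃ e : X ≃ Y, w = b ∘ e) ↔
      ∀ c, Fintype.card {x // w x = c} = Fintype.card {y // b y = c} := by
  constructor
  · rintro ⟨e, rfl⟩ c
    exact Fintype.card_congr (e.subtypeEquiv fun x => Iff.rfl)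
  · intro h
    refine ⟨(Equiv.sigmaFiberEquiv w).symm.trans ((Equiv.sigmaCongrRight fun c =>
      Fintype.equivOfCardEq (h c)).trans (Equiv.sigmaFiberEquiv b)), ?_⟩
    ext x
    simp only [Function.comp_apply, Equiv.trans_apply, Equiv.sigmaCongrRight_apply]
    exact ((Fintype.equivOfCardEq (h (w x))) ⟨x, rfl⟩).2.symm

/-- The number of functions with prescribed sizes of the fibres is a multinomial coefficient. -/
theorem card_functions_with_fibers {X κ : Type*} [Fintype X] [DecidableEq X] [Fintype κ]
    [DecidableEq κ] (γ : κ → ℕ) (hγ : ∑ c, γ c = Fintype.card X) :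
    (Finset.univ.filter fun v : X → κ => ∀ c, Fintype.card {x // v x = c} = γ c).card *
      ∏ c, (γ c).factorial = (Fintype.card X).factorial := by
  have e : X ≃ Σ c, Fin (γ c) := Fintype.equivOfCardEq (by simp [hγ])
  let v₀ : X → κ := fun x => (e x).1
  have hv₀ : ∀ c, Fintype.card {x // v₀ x = c} = γ c := by
    intro c
    rw [Fintype.card_congr (e.subtypeEquiv (q := fun y => y.1 = c) fun x => Iff.rfl),
      Fintype.card_congr (Equiv.sigmaSubtype c), Fintype.card_fin]
  rw [← Fintype.card_perm, ← Finset.card_univ (α := Perm X),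
    Finset.card_eq_sum_card_fiberwise (f := fun σ : Perm X => v₀ ∘ σ)
    (t := Finset.univ.filter fun v : X → κ => ∀ c, Fintype.card {x // v x = c} = γ c)]
  · refine (Finset.sum_const_nat fun v hv => ?_).symm
    obtain ⟨σ, rfl⟩ := (exists_eq_comp_equiv_iff v v₀).2 fun c => by
      rw [hv₀, (Finset.mem_filter.1 hv).2 c]
    -- The permutations that carry `v₀` to a given word form a coset of the stabilizer of `v₀`,
    -- whose order is the product of the factorials.
    rw [← Finset.prod_congr rfl fun c _ => congrArg Nat.factorial (hv₀ c),
      ← DomMulAct.stabilizer_card v₀, Fintype.card_subtype]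
    refine Finset.card_equiv (Equiv.mulRight σ⁻¹) fun τ => ?_
    simp only [Finset.mem_filter, Finset.mem_univ, true_and, Equiv.coe_mulRight]
    constructor <;> intro h <;> ext x
    · simpa using congrFun h (σ⁻¹ x)
    · simpa using congrFun h (σ x)
  · intro σ _
    simp only [Finset.coe_filter, Finset.mem_univ, true_and, Set.mem_ofPred_eq]
    intro c
    rw [← hv₀ c]
    exact (exists_eq_comp_equiv_iff (v₀ ∘ σ) v₀).1 ⟨σ, rfl⟩ c

/-- The fibres of a surjective homomorphism are translates of each other. -/
theorem card_fiber_castHom {n N d : ℕ} [NeZero n] [NeZero N] (h : N * d = n) (j : ZMod N) :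
    Fintype.card {i : ZMod n // ZMod.castHom (Dvd.intro d h) (ZMod N) i = j} = d := by
  have hs := ZMod.castHom_surjective (Dvd.intro d h : N ∣ n)
  have hall : ∀ j' : ZMod N,
      Fintype.card {i : ZMod n // ZMod.castHom (Dvd.intro d h) (ZMod N) i = j'} =
      Fintype.card {i : ZMod n // ZMod.castHom (Dvd.intro d h) (ZMod N) i = j} := by
    intro j'
    obtain ⟨a, ha⟩ := hs (j - j')
    refine Fintype.card_congr ((Equiv.addRight a).subtypeEquiv fun i => ?_)
    rw [Equiv.coe_addRight, map_add, ha]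
    constructor
    · rintro rfl; ring
    · intro h; linear_combination h
  have h1 := Fintype.card_congr
    (Equiv.sigmaFiberEquiv (ZMod.castHom (Dvd.intro d h : N ∣ n) (ZMod N)))
  rw [Fintype.card_sigma, Finset.sum_congr rfl fun j' _ => hall j', ZMod.card, Finset.sum_const,
    Finset.card_univ, ZMod.card, smul_eq_mul] at h1
  exact Nat.eq_of_mul_eq_mul_left (Nat.pos_of_ne_zero (NeZero.ne N)) (h1.trans h.symm)

theorem card_fiber_comp_castHom {n N d : ℕ} [NeZero n] [NeZero N] {κ : Type*} [DecidableEq κ]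
    (h : N * d = n) (v : ZMod N → κ) (c : κ) :
    Fintype.card {i : ZMod n // v (ZMod.castHom (Dvd.intro d h) (ZMod N) i) = c} =
      d * Fintype.card {j : ZMod N // v j = c} := by
  rw [Fintype.card_subtype, Finset.card_eq_sum_card_fiberwise
    (f := ZMod.castHom (Dvd.intro d h : N ∣ n) (ZMod N))
    (t := Finset.univ.filter fun j => v j = c)]
  · rw [Fintype.card_subtype, mul_comm]
    refine Finset.sum_const_nat fun j hj => ?_
    have hj := (Finset.mem_filter.1 hj).2
    refine Eq.trans ?_ (card_fiber_castHom h j)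
    rw [Fintype.card_subtype, Finset.filter_filter]
    congr 1
    ext i
    simp only [Finset.mem_filter, Finset.mem_univ, true_and, and_iff_right_iff_imp]
    rintro rfl
    exact hj
  · intro i hi
    exact Finset.mem_coe.2 (Finset.mem_filter.2 ⟨Finset.mem_univ _, (Finset.mem_filter.1 hi).2⟩)

/-- The words of content `b` that are invariant under the translation by `N`. -/
theorem card_periodic_words {n N d : ℕ} [NeZero n] [NeZero N] {κ : Type*} [Fintype κ]
    [DecidableEq κ] (h : N * d = n) (b : Fin n → κ)
    [DecidablePred fun w : ZMod n → κ =>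
      (∃ e : ZMod n ≃ Fin n, w = b ∘ e) ∧ ∀ i, w (i + (N : ℕ)) = w i] :
    ((Finset.univ.filter fun w : ZMod n → κ =>
      (∃ e : ZMod n ≃ Fin n, w = b ∘ e) ∧ ∀ i, w (i + (N : ℕ)) = w i).card : ℚ) =
      N.factorial * ∏ c, if d ∣ Fintype.card {a // b a = c} then
        (((Fintype.card {a // b a = c} / d).factorial : ℚ))⁻¹ else 0 := by
  have hd0 : 0 < d := Nat.pos_of_ne_zero (by rintro rfl; exact NeZero.ne n (by omega))
  set hom := ZMod.castHom (Dvd.intro d h : N ∣ n) (ZMod N) with hhom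
  have hcount : (Finset.univ.filter fun w : ZMod n → κ =>
      (∃ e : ZMod n ≃ Fin n, w = b ∘ e) ∧ ∀ i, w (i + (N : ℕ)) = w i).card =
      (Finset.univ.filter fun v : ZMod N → κ =>
        ∀ c, d * Fintype.card {j // v j = c} = Fintype.card {a // b a = c}).card := by
    -- The invariant words are the pullbacks of words on `ZMod N`, and a pullback multiplies each
    -- letter count by `d`.
    symm
    refine Finset.card_bij (fun v _ => v ∘ hom) ?_ ?_ ?_
    · intro v hv
      have hv := (Finset.mem_filter.1 hv).2
      refine Finset.mem_filter.2 ⟨Finset.mem_univ _, ?_, fun i => by simp⟩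
      rw [exists_eq_comp_equiv_iff]
      intro c
      rw [← hv c, ← card_fiber_comp_castHom h]
      rfl
    · intro v _ v' _ hvv
      exact (ZMod.castHom_surjective _).injective_comp_right hvv
    · intro w hw
      obtain ⟨hw1, hw2⟩ := (Finset.mem_filter.1 hw).2
      have hmul : ∀ (m : ℕ) (i : ZMod n), w (i + (N * m : ℕ)) = w i := by
        intro m
        induction m with
        | zero => simp
        | succ m ih =>
          intro i
          rw [Nat.mul_succ, Nat.cast_add, ← add_assoc, hw2, ih]
      have hwv : (fun j : ZMod N => w (j.val : ZMod n)) ∘ hom = w := by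
        ext i
        have h1 : (hom i).val = i.val % N := by
          rw [hhom, ZMod.castHom_apply, ← ZMod.natCast_val, ZMod.val_natCast]
        have h2 := hmul (i.val / N) ((i.val % N : ℕ) : ZMod n)
        rw [← Nat.cast_add, Nat.mod_add_div] at h2
        simp only [Function.comp_apply, h1, ← h2]
        simp
      refine ⟨fun j => w (j.val : ZMod n), Finset.mem_filter.2 ⟨Finset.mem_univ _, fun c => ?_⟩, hwv⟩
      rw [← card_fiber_comp_castHom h, ← (exists_eq_comp_equiv_iff w b).1 hw1]
      exact Fintype.card_congr (Equiv.subtypeEquivRight fun i => by rw [← congrFun hwv i]; rfl)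
  rw [hcount]
  by_cases hdiv : ∀ c, d ∣ Fintype.card {a // b a = c}
  · have hsum : ∑ c, Fintype.card {a // b a = c} / d = Fintype.card (ZMod N) := by
      have h1 := Fintype.card_congr (Equiv.sigmaFiberEquiv b)
      rw [Fintype.card_sigma, Fintype.card_fin] at h1
      rw [ZMod.card]
      refine Nat.eq_of_mul_eq_mul_right hd0 ?_
      rw [h, Finset.sum_mul]
      refine Eq.trans ?_ h1
      exact Finset.sum_congr rfl fun c _ => Nat.div_mul_cancel (hdiv c)
    have key := card_functions_with_fibers (X := ZMod N) _ hsum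
    rw [ZMod.card] at key
    rw [Finset.prod_congr rfl fun c _ => if_pos (hdiv c), ← key, Finset.prod_inv_distrib]
    push_cast
    rw [mul_assoc, mul_inv_cancel₀, mul_one]
    · congr 2
      ext v
      simp only [Finset.mem_filter, Finset.mem_univ, true_and]
      exact forall_congr' fun c => by
        rw [Nat.eq_div_iff_mul_eq_left hd0.ne' (hdiv c), mul_comm, eq_comm]
    · exact Finset.prod_ne_zero_iff.2 fun c _ => by exact_mod_cast Nat.factorial_ne_zero _
  · push Not at hdiv
    obtain ⟨c, hc⟩ := hdiv
    rw [Finset.prod_eq_zero (Finset.mem_univ c) (if_neg hc), mul_zero, Finset.filter_false_of_mem]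
    · simp
    · intro v _ hv
      exact hc (hv c ▸ Dvd.intro _ rfl)

/-- The number of full cycles that are increasing on the fibres of a monotone map. -/
theorem card_fullCycles_increasing {n : ℕ} [NeZero n] {κ : Type*} [LinearOrder κ] [Fintype κ]
    (b : Fin n → κ) (hb : Monotone b)
    [DecidablePred fun π : Perm (Fin n) => IsFullCycle π ∧ IsIncreasingOnFibers b π] :
    (n : ℚ) * (Finset.univ.filter fun π : Perm (Fin n) =>
        IsFullCycle π ∧ IsIncreasingOnFibers b π).card =
      ∑ d ∈ n.divisors, (ArithmeticFunction.moebius d : ℚ) * ((n / d).factorial *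
        ∏ c, if d ∣ Fintype.card {a // b a = c} then
          (((Fintype.card {a // b a = c} / d).factorial : ℚ))⁻¹ else 0) := by
  classical
  have h1 := card_mul_card_fullCycles (IsIncreasingOnFibers b)
  rw [card_labelings_eq_card_words b hb] at h1
  have h2 : ((Finset.univ.filter fun w : ZMod n → κ => (∃ e : ZMod n ≃ Fin n, w = b ∘ e) ∧
        ∀ d : ZMod n, (∀ i, w (i + d) = w i) → d = 0).card : ℤ) =
      ∑ d ∈ n.divisors, ArithmeticFunction.moebius d * (Finset.univ.filter fun w : ZMod n → κ =>
        (∃ e : ZMod n ≃ Fin n, w = b ∘ e) ∧ ∀ i, w (i + (n / d : ℕ)) = w i).card := by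
    rw [← Finset.filter_filter, Finset.card_filter]
    push_cast
    simp only [← sum_moebius_periods]
    rw [Finset.sum_comm]
    refine Finset.sum_congr rfl fun d _ => ?_
    rw [← Finset.sum_filter, Finset.sum_const, Finset.filter_filter, nsmul_eq_mul, mul_comm]
  have h3 : ((n * (Finset.univ.filter fun π : Perm (Fin n) =>
      IsFullCycle π ∧ IsIncreasingOnFibers b π).card : ℕ) : ℚ) = _ :=
    (congrArg (fun x : ℕ => (x : ℚ)) h1).trans (congrArg (fun x : ℤ => (x : ℚ)) h2)
  push_cast at h3
  rw [h3]
  refine Finset.sum_congr rfl fun d hd => ?_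
  obtain ⟨hdn, -⟩ := Nat.mem_divisors.1 hd
  have : NeZero (n / d) := ⟨(Nat.div_pos (Nat.divisor_le hd) (Nat.pos_of_mem_divisors hd)).ne'⟩
  rw [card_periodic_words (Nat.div_mul_cancel hdn)]

/-! ### Newton's identity for unimodal and increasing segments. -/

/-- The word `x s, x (s + 1), …, x (s + m - 1)` is increasing. -/
def IsIncreasingRun (x : ℕ → ℕ) (s m : ℕ) : Prop :=
  ∀ j, j + 1 < m → x (s + j) < x (s + j + 1)

open Classical in
noncomputable def runIndicator (x : ℕ → ℕ) (s m : ℕ) : ℤ := if IsIncreasingRun x s m then 1 else 0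

/-- The sign `(-1) ^ des` of the word `x s, …, x (s + m - 1)` if it is unimodal, and zero otherwise
(see `unimodalSign_eq`). -/
noncomputable def unimodalSign (x : ℕ → ℕ) (s : ℕ) : ℕ → ℤ
  | 0 => 0
  | 1 => 1
  | m + 2 => if x (s + m) < x (s + m + 1) then runIndicator x s (m + 2) else -unimodalSign x s (m + 1)

theorem isIncreasingRun_of_le_one {x : ℕ → ℕ} {s m : ℕ} (hm : m ≤ 1) : IsIncreasingRun x s m :=
  fun j hj => by omega

theorem isIncreasingRun_succ {x : ℕ → ℕ} {s m : ℕ} :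
    IsIncreasingRun x s (m + 2) ↔ IsIncreasingRun x s (m + 1) ∧ x (s + m) < x (s + m + 1) := by
  constructor
  · exact fun h => ⟨fun j hj => h j (by omega), h m (by omega)⟩
  · rintro ⟨h1, h2⟩ j hj
    rcases Nat.lt_or_ge j m with h | h
    · exact h1 j (by omega)
    · obtain rfl : j = m := by omega
      exact h2

theorem runIndicator_of_le_one {x : ℕ → ℕ} {s m : ℕ} (hm : m ≤ 1) : runIndicator x s m = 1 :=
  if_pos (isIncreasingRun_of_le_one hm)

theorem runIndicator_succ {x : ℕ → ℕ} {s m : ℕ} :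
    runIndicator x s (m + 2) = if x (s + m) < x (s + m + 1) then runIndicator x s (m + 1) else 0 := by
  unfold runIndicator
  rw [isIncreasingRun_succ]
  split_ifs <;> simp_all

/-- The analogue of Newton's identity that relates power sums and complete symmetric functions. -/
theorem sum_unimodalSign_mul_runIndicator (x : ℕ → ℕ) (s m : ℕ) :
    ∑ t ∈ Finset.range m, unimodalSign x s (t + 1) * runIndicator x (s + (t + 1)) (m - (t + 1)) =
      m * runIndicator x s m := by
  induction m with
  | zero => simp
  | succ m ih =>
    rcases m with _ | k
    · simp [unimodalSign, runIndicator_of_le_one]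
    · rw [Finset.sum_range_succ, Nat.sub_self, runIndicator_of_le_one (Nat.zero_le _), mul_one,
        unimodalSign, runIndicator_succ]
      -- If the word ends with an ascent, dropping its last letter changes no earlier term and the
      -- induction hypothesis applies. Otherwise only the last two cuts leave an increasing right
      -- part, and their terms cancel.
      split_ifs with h
      · rw [Finset.sum_congr rfl (g := fun t => unimodalSign x s (t + 1) *
          runIndicator x (s + (t + 1)) (k + 1 - (t + 1))), ih]
        · push_cast; ring
        · intro t ht
          rw [Finset.mem_range] at ht
          congr 1
          rcases Nat.lt_or_ge t k with htk | htk
          · obtain ⟨r, rfl⟩ := Nat.exists_eq_add_of_lt htk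
            rw [show t + r + 1 + 1 + 1 - (t + 1) = r + 2 by omega,
              show t + r + 1 + 1 - (t + 1) = r + 1 by omega, runIndicator_succ, if_pos]
            convert h using 2 <;> ring
          · rw [runIndicator_of_le_one (by omega), runIndicator_of_le_one (by omega)]
      · rw [Finset.sum_range_succ, Finset.sum_eq_zero, runIndicator_of_le_one (by omega)]
        · ring
        · intro t ht
          rw [Finset.mem_range] at ht
          obtain ⟨r, rfl⟩ := Nat.exists_eq_add_of_lt ht
          rw [show t + r + 1 + 1 + 1 - (t + 1) = r + 2 by omega, runIndicator_succ, if_neg, mul_zero]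
          convert h using 3 <;> ring

/-- The weight of a word at a block: a block of the first kind asks for a unimodal word and gives it
a sign, a block of the second kind asks for an increasing word. -/
noncomputable def blockWeight (x : ℕ → ℕ) (s : ℕ) (p : Bool × ℕ) : ℤ :=
  if p.1 then unimodalSign x s p.2 else runIndicator x s p.2

/-- The product of the weights of a word at consecutive blocks, from the position `s` on. -/
noncomputable def wordWeight (x : ℕ → ℕ) : List (Bool × ℕ) → ℕ → ℤ
  | [], _ => 1
  | p :: L, s => blockWeight x s p * wordWeight x L (s + p.2)

theorem wordWeight_append (x : ℕ → ℕ) (A B : List (Bool × ℕ)) (s : ℕ) :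
    wordWeight x (A ++ B) s = wordWeight x A s * wordWeight x B (s + (A.map Prod.snd).sum) := by
  induction A generalizing s with
  | nil => simp [wordWeight]
  | cons p A ih => simp [wordWeight, ih, mul_assoc, add_assoc]

/-- Newton's identity solved for its last term inside a product of blocks: a unimodal block is
traded for increasing blocks and shorter unimodal ones. -/
theorem wordWeight_unimodal_block (x : ℕ → ℕ) (A B : List (Bool × ℕ)) (m s : ℕ) :
    wordWeight x (A ++ (true, m + 1) :: B) s =
      (m + 1) * wordWeight x (A ++ (false, m + 1) :: B) s -
        ∑ t ∈ Finset.range m, wordWeight x (A ++ (true, t + 1) :: (false, m - t) :: B) s := by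
  simp only [wordWeight_append, wordWeight, blockWeight, if_true, Bool.false_eq_true, if_false]
  set s' := s + (A.map Prod.snd).sum
  have h := sum_unimodalSign_mul_runIndicator x s' (m + 1)
  rw [Finset.sum_range_succ, Nat.sub_self, runIndicator_of_le_one (Nat.zero_le _), mul_one] at h
  have h2 : ∑ t ∈ Finset.range m, wordWeight x A s * (unimodalSign x s' (t + 1) *
      (runIndicator x (s' + (t + 1)) (m - t) * wordWeight x B (s' + (t + 1) + (m - t)))) =
      wordWeight x A s * ((∑ t ∈ Finset.range m, unimodalSign x s' (t + 1) *
        runIndicator x (s' + (t + 1)) (m + 1 - (t + 1))) * wordWeight x B (s' + (m + 1))) := by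
    rw [Finset.sum_mul, Finset.mul_sum]
    refine Finset.sum_congr rfl fun t ht => ?_
    rw [Finset.mem_range] at ht
    rw [Nat.add_sub_add_right, show s' + (t + 1) + (m - t) = s' + (m + 1) by omega]
    ring
  rw [h2, eq_sub_of_add_eq' h]
  push_cast
  ring

/-- The contribution of a block to the number of the words that are `d`-th powers. -/
noncomputable def blockCount (d : ℕ) (p : Bool × ℕ) : ℚ :=
  if p.1 then (if p.2 = d then (d : ℚ) else 0)
  else if d ∣ p.2 then (((p.2 / d).factorial : ℚ))⁻¹ else 0

/-- This is Newton's identity for the specialization p_d = d, other p_m = 0, whose complete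
symmetric functions have generating function exp(x^d). Only the term `t + 1 = d` of the sum can
survive. -/
theorem blockCount_unimodal {d : ℕ} (hd : 0 < d) (m : ℕ) :
    blockCount d (true, m + 1) = (m + 1) * blockCount d (false, m + 1) -
      ∑ t ∈ Finset.range m, blockCount d (true, t + 1) * blockCount d (false, m - t) := by
  obtain ⟨e, rfl⟩ : ∃ e, d = e + 1 := ⟨d - 1, by omega⟩
  simp only [blockCount, if_true, Bool.false_eq_true, if_false, Nat.add_right_cancel_iff, ite_mul,
    zero_mul, Finset.sum_ite_eq', Finset.mem_range]
  rcases lt_trichotomy m e with h | rfl | h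
  · have h1 : ¬ e + 1 ∣ m + 1 := fun h' => by
      have := Nat.le_of_dvd (Nat.succ_pos _) h'; omega
    rw [if_neg h.ne, if_neg h1, if_neg (by omega)]
    simp
  · simp
  · rw [if_neg h.ne', if_pos h]
    have hiff : e + 1 ∣ m + 1 ↔ e + 1 ∣ m - e := by
      rw [show m + 1 = (m - e) + (e + 1) by omega]
      simp
    by_cases hdvd : e + 1 ∣ m - e
    · rw [if_pos hdvd, if_pos (hiff.2 hdvd)]
      obtain ⟨q, hq⟩ := hdvd
      have hm : m + 1 = (e + 1) * (q + 1) := by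
        rw [Nat.mul_add, ← hq]; omega
      have hm' : (m : ℚ) + 1 = (e + 1) * (q + 1) := by exact_mod_cast hm
      rw [hq, hm, hm', Nat.mul_div_cancel_left _ hd, Nat.mul_div_cancel_left _ hd,
        Nat.factorial_succ]
      have : (q : ℚ) + 1 ≠ 0 := by positivity
      have : (q.factorial : ℚ) ≠ 0 := by exact_mod_cast q.factorial_ne_zero
      push_cast
      field_simp
      ring
    · rw [if_neg hdvd, if_neg (mt hiff.1 hdvd)]
      simp

/-! ### From words to permutations. -/

/-- The one-line notation of a permutation, extended by zeros. -/
def oneLine {n : ℕ} (π : Perm (Fin n)) (j : ℕ) : ℕ := if h : j < n then π ⟨j, h⟩ else 0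

theorem oneLine_coe {n : ℕ} (π : Perm (Fin n)) (a : Fin n) : oneLine π a = π a := by
  simp [oneLine]

theorem wordWeight_map (x : ℕ → ℕ) (t : Bool) (l : List ℕ) (s : ℕ) :
    wordWeight x (l.map fun m => (t, m)) s =
      ∏ i : Fin l.length, blockWeight x (s + (l.take i).sum) (t, l.get i) := by
  induction l generalizing s with
  | nil => simp [wordWeight]
  | cons m l ih =>
    rw [List.map_cons, wordWeight, ih]
    simp only [List.length_cons]
    rw [Fin.prod_univ_succ]
    simp [add_assoc]

theorem wordWeight_composition {n : ℕ} (x : ℕ → ℕ) (t : Bool) (c : Composition n) :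
    wordWeight x (c.blocks.map fun m => (t, m)) 0 =
      ∏ i : Fin c.length, blockWeight x (c.sizeUpTo i) (t, c.blocksFun i) := by
  rw [wordWeight_map]
  simp only [zero_add]
  rfl

theorem IsIncreasingRun.lt {x : ℕ → ℕ} {s m : ℕ} (h : IsIncreasingRun x s m) {i j : ℕ} (hij : i < j)
    (hj : j < m) : x (s + i) < x (s + j) := by
  induction j, hij using Nat.le_induction with
  | base => exact h i hj
  | succ j _ ih => exact (ih (by omega)).trans (h j hj)

theorem isIncreasingOnFibers_index {n : ℕ} (c : Composition n) (π : Perm (Fin n)) :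
    IsIncreasingOnFibers c.index π ↔
      ∀ i : Fin c.length, IsIncreasingRun (oneLine π) (c.sizeUpTo i) (c.blocksFun i) := by
  constructor
  · intro h i j hj
    have := h (c.embedding i ⟨j, by omega⟩) (c.embedding i ⟨j + 1, hj⟩) (by simp)
      (by rw [c.index_embedding, c.index_embedding])
    rw [Fin.lt_def, ← oneLine_coe, ← oneLine_coe, c.coe_embedding, c.coe_embedding] at this
    exact this
  · intro h a a' haa hc
    have h1 : ((c.embedding (c.index a) (c.invEmbedding a) : Fin n) : ℕ) = a := by
      rw [c.embedding_comp_inv]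
    have h2 : ((c.embedding (c.index a') (c.invEmbedding a') : Fin n) : ℕ) = a' := by
      rw [c.embedding_comp_inv]
    rw [c.coe_embedding] at h1 h2
    have h3 : c.sizeUpTo (c.index a) + c.invEmbedding a' = a' := by rw [hc]; exact h2
    have hlt : (c.invEmbedding a' : ℕ) < c.blocksFun (c.index a) := by
      rw [hc]; exact (c.invEmbedding a').2
    have := (h (c.index a)).lt (i := c.invEmbedding a) (j := c.invEmbedding a') (by omega) hlt
    rwa [h1, h3, oneLine_coe, oneLine_coe, ← Fin.lt_def] at this

theorem index_monotone {n : ℕ} (c : Composition n) : Monotone c.index := by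
  intro a b hab
  by_contra h
  rw [not_le, Fin.lt_def] at h
  have h1 := c.sizeUpTo_index_le a
  have h2 : (b : ℕ) < c.sizeUpTo ((c.index b : ℕ) + 1) := c.lt_sizeUpTo_index_succ b
  have h3 := c.monotone_sizeUpTo (show (c.index b : ℕ) + 1 ≤ c.index a from h)
  have h4 : (a : ℕ) ≤ b := hab
  omega

theorem card_index_fiber {n : ℕ} (c : Composition n) (i : Fin c.length) :
    Fintype.card {a // c.index a = i} = c.blocksFun i := by
  rw [← Fintype.card_fin (c.blocksFun i)]
  refine (Fintype.card_congr (Equiv.ofBijective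
    (fun j => (⟨c.embedding i j, c.index_embedding i j⟩ : {a // c.index a = i})) ⟨?_, ?_⟩)).symm
  · intro j j' h
    exact (c.embedding i).injective (congrArg Subtype.val h)
  · rintro ⟨a, rfl⟩
    exact ⟨c.invEmbedding a, Subtype.ext (c.embedding_comp_inv a)⟩

-- This is `card_fullCycles_increasing` for the map `c.index`, whose fibres are the segments of `c`.
open Classical in
theorem sum_wordWeight_increasing {n : ℕ} [NeZero n] (c : Composition n) :
    (n : ℚ) * ∑ π : Perm (Fin n) with IsFullCycle π,
        (wordWeight (oneLine π) (c.blocks.map fun m => (false, m)) 0 : ℚ) =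
      ∑ d ∈ n.divisors, (ArithmeticFunction.moebius d : ℚ) * ((n / d).factorial *
        ((c.blocks.map fun m => (false, m)).map (blockCount d)).prod) := by
  have h := card_fullCycles_increasing c.index (index_monotone c)
  simp only [card_index_fiber] at h
  rw [← Finset.filter_filter, Finset.card_filter] at h
  push_cast at h
  have h1 : ∀ π : Perm (Fin n), wordWeight (oneLine π) (c.blocks.map fun m => (false, m)) 0 =
      if IsIncreasingOnFibers c.index π then 1 else 0 := by
    intro π
    rw [wordWeight_composition, isIncreasingOnFibers_index]
    simp [blockWeight, runIndicator, Finset.prod_ite_zero]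
  simp only [h1]
  push_cast
  rw [h]
  refine Finset.sum_congr rfl fun d _ => ?_
  rw [← c.ofFn_blocksFun, List.map_map, List.map_ofFn, List.prod_ofFn]
  rfl

-- The two sides obey the same recursion, `wordWeight_unimodal_block` on the left and, for each `d`
-- separately, `blockCount_unimodal` on the right. The induction is on the total length of the
-- unimodal blocks; mixed lists are needed because the recursion leaves the purely unimodal ones.
open Classical in
theorem sum_wordWeight {n : ℕ} [NeZero n] (L : List (Bool × ℕ)) (hpos : ∀ p ∈ L, 0 < p.2)
    (hsum : (L.map Prod.snd).sum = n) :
    (n : ℚ) * ∑ π : Perm (Fin n) with IsFullCycle π, (wordWeight (oneLine π) L 0 : ℚ) =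
      ∑ d ∈ n.divisors, (ArithmeticFunction.moebius d : ℚ) * ((n / d).factorial *
        (L.map (blockCount d)).prod) := by
  induction hM : (L.map fun p => if p.1 then p.2 else 0).sum using Nat.strong_induction_on
    generalizing L with
  | _ M ih =>
  by_cases hL : ∃ p ∈ L, p.1 = true
  · obtain ⟨⟨_, m⟩, hp, rfl⟩ := hL
    obtain ⟨m, rfl⟩ : ∃ k, m = k + 1 := ⟨m - 1, by have := hpos _ hp; simp at this; omega⟩
    obtain ⟨A, B, rfl⟩ := List.append_of_mem hp
    simp at hM hsum
    have hA : ∀ p ∈ A, 0 < p.2 := fun p h => hpos p (by simp [h])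
    have hB : ∀ p ∈ B, 0 < p.2 := fun p h => hpos p (by simp [h])
    have ih1 := ih _ (by
        simp
        omega) (A ++ (false, m + 1) :: B) (by
        intro p hp
        simp only [List.mem_append, List.mem_cons] at hp
        rcases hp with h | rfl | h
        exacts [hA p h, Nat.succ_pos _, hB p h]) (by
        simp
        omega) rfl
    have ih2 : ∀ t ∈ Finset.range m, _ := fun t ht => ih _ (by
        rw [Finset.mem_range] at ht
        simp
        omega) (A ++ (true, t + 1) :: (false, m - t) :: B) (by
        rw [Finset.mem_range] at ht
        intro p hp
        simp only [List.mem_append, List.mem_cons] at hp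
        rcases hp with h | rfl | rfl | h
        exacts [hA p h, Nat.succ_pos _, Nat.sub_pos_of_lt ht, hB p h]) (by
        rw [Finset.mem_range] at ht
        simp
        omega) rfl
    simp only [fun π : Perm (Fin n) => wordWeight_unimodal_block (oneLine π) A B m 0]
    push_cast
    rw [Finset.sum_sub_distrib, ← Finset.mul_sum, Finset.sum_comm, mul_sub, mul_left_comm, ih1,
      Finset.mul_sum (Finset.range m), Finset.sum_congr rfl ih2, Finset.sum_comm, Finset.mul_sum,
      ← Finset.sum_sub_distrib]
    refine Finset.sum_congr rfl fun d hd => ?_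
    simp only [List.map_append, List.map_cons, List.prod_append, List.prod_cons]
    rw [blockCount_unimodal (Nat.pos_of_mem_divisors hd), sub_mul, Finset.sum_mul, mul_sub, mul_sub,
      mul_sub]
    congr 1
    · ring
    · simp only [Finset.mul_sum]
      exact Finset.sum_congr rfl fun t _ => by ring
  · have hL' : L = (L.map Prod.snd).map fun m => (false, m) := by
      rw [List.map_map]
      conv_lhs => rw [← List.map_id L]
      refine List.map_congr_left fun p hp => ?_
      have : p.1 = false := by
        by_contra h
        exact hL ⟨p, hp, by simpa using h⟩
      exact Prod.ext this rfl
    have := sum_wordWeight_increasing (n := n) ⟨L.map Prod.snd, by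
      intro i hi
      obtain ⟨p, hp, rfl⟩ := List.mem_map.1 hi
      exact hpos p hp, hsum⟩
    simpa only [← hL'] using this

/-! ### Unimodal segments and descents. -/

/-- The word `x s, …, x (s + m - 1)` is unimodal. -/
def IsUnimodalRun (x : ℕ → ℕ) (s m : ℕ) : Prop :=
  ∃ p < m, (∀ j < p, x (s + j) < x (s + j + 1)) ∧
    ∀ j, p ≤ j → j + 1 < m → x (s + j + 1) < x (s + j)

theorem isUnimodalRun_succ_of_lt {x : ℕ → ℕ} {s m : ℕ} (h : x (s + m) < x (s + m + 1)) :
    IsUnimodalRun x s (m + 2) ↔ IsIncreasingRun x s (m + 2) := by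
  constructor
  · rintro ⟨p, hp, h1, h2⟩ j hj
    refine h1 j ?_
    by_contra hjp
    exact absurd (h2 m (by omega) (by omega)) (by omega)
  · exact fun h => ⟨m + 1, by omega, fun j hj => h j (by omega), fun j hj hj' => by omega⟩

theorem isUnimodalRun_succ_of_gt {x : ℕ → ℕ} {s m : ℕ} (h : x (s + m + 1) < x (s + m)) :
    IsUnimodalRun x s (m + 2) ↔ IsUnimodalRun x s (m + 1) := by
  constructor
  · rintro ⟨p, hp, h1, h2⟩
    refine ⟨p, ?_, h1, fun j hj hj' => h2 j hj (by omega)⟩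
    by_contra hpm
    exact absurd (h1 m (by omega)) (by omega)
  · rintro ⟨p, hp, h1, h2⟩
    refine ⟨p, by omega, h1, fun j hj hj' => ?_⟩
    rcases Nat.lt_or_ge j m with hjm | hjm
    · exact h2 j hj (by omega)
    · obtain rfl : j = m := by omega
      exact h

-- A unimodal word that ends with an ascent is increasing and has no descents; a final descent
-- preserves unimodality and contributes one sign. Adjacent letters must differ since the recursion
-- counts a tie as a descent.
open Classical in
theorem unimodalSign_eq {x : ℕ → ℕ} {s m : ℕ} (hm : 0 < m)
    (hx : ∀ j, j + 1 < m → x (s + j) ≠ x (s + j + 1)) :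
    unimodalSign x s m = if IsUnimodalRun x s m then
      (-1) ^ ((Finset.range (m - 1)).filter fun j => x (s + j + 1) < x (s + j)).card else 0 := by
  induction m with
  | zero => omega
  | succ m ih =>
    rcases m with _ | m
    · rw [if_pos ⟨0, by omega, fun j hj => by omega, fun j hj hj' => by omega⟩]
      simp [unimodalSign]
    · rw [unimodalSign]
      have ih := ih (by omega) fun j hj => hx j (by omega)
      rcases lt_or_gt_of_ne (hx m (by omega)) with h | h
      · rw [if_pos h, isUnimodalRun_succ_of_lt h, runIndicator]
        refine if_ctx_congr Iff.rfl (fun hinc => ?_) fun _ => rfl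
        rw [Finset.filter_false_of_mem, Finset.card_empty, pow_zero]
        intro j hj
        rw [Finset.mem_range] at hj
        exact (hinc j (by omega)).not_gt
      · rw [if_neg h.not_gt, ih, isUnimodalRun_succ_of_gt h, show m + 1 + 1 - 1 = m + 1 by omega,
          Nat.add_sub_cancel, Finset.range_add_one, Finset.filter_insert, if_pos h,
          Finset.card_insert_of_notMem (by simp)]
        split_ifs
        · ring
        · simp

theorem strictMonoOn_Iic_iff {l : ℕ} {y : Fin l → ℕ} {p : Fin l} :
    StrictMonoOn y (Set.Iic p) ↔
      ∀ j : ℕ, ∀ hj : j < p, y ⟨j, hj.trans p.2⟩ < y ⟨j + 1, lt_of_le_of_lt hj p.2⟩ := by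
  constructor
  · intro h j hj
    exact h (Set.mem_Iic.2 (Fin.le_def.2 hj.le)) (Set.mem_Iic.2 (Fin.le_def.2 hj))
      (Fin.lt_def.2 j.lt_succ_self)
  · intro h
    have key : ∀ i j : ℕ, ∀ hij : i < j, ∀ hj : j ≤ p,
        y ⟨i, (hij.trans_le hj).trans p.2⟩ < y ⟨j, hj.trans_lt p.2⟩ := by
      intro i j hij
      induction j, hij using Nat.le_induction with
      | base => exact fun hj => h i hj
      | succ j _ ih => exact fun hj => (ih (by omega)).trans (h j hj)
    exact fun i _ j hj hij => key i j hij hj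

theorem strictAntiOn_Ici_iff {l : ℕ} {y : Fin l → ℕ} {p : Fin l} :
    StrictAntiOn y (Set.Ici p) ↔
      ∀ j, (p : ℕ) ≤ j → ∀ hj : j + 1 < l, y ⟨j + 1, hj⟩ < y ⟨j, (Nat.lt_succ_self j).trans hj⟩ := by
  constructor
  · intro h j hp hj
    exact h (Set.mem_Ici.2 (Fin.le_def.2 hp)) (Set.mem_Ici.2 (Fin.le_def.2 (hp.trans j.le_succ)))
      (Fin.lt_def.2 j.lt_succ_self)
  · intro h
    have key : ∀ i j : ℕ, (p : ℕ) ≤ i → ∀ hij : i < j, ∀ hj : j < l, y ⟨j, hj⟩ < y ⟨i, hij.trans hj⟩ := by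
      intro i j hi hij
      induction j, hij using Nat.le_induction with
      | base => exact fun hj => h i hi hj
      | succ j hij ih => exact fun hj => (h j (by omega) hj).trans (ih (by omega))
    exact fun i hi j _ hij => key i j hi hij j.2

theorem isUnimodal_iff_isUnimodalRun {n : ℕ} (c : Composition n) (π : Perm (Fin n))
    (i : Fin c.length) :
    (IsUnimodal fun j : Fin (c.blocksFun i) => π (c.embedding i j)) ↔
      IsUnimodalRun (oneLine π) (c.sizeUpTo i) (c.blocksFun i) := by
  have h : ∀ j : Fin (c.blocksFun i),
      (π (c.embedding i j) : ℕ) = oneLine π (c.sizeUpTo i + j) := by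
    intro j
    rw [← c.coe_embedding, oneLine_coe]
  have hmono : ∀ s : Set (Fin (c.blocksFun i)),
      StrictMonoOn (fun j => π (c.embedding i j)) s ↔
        StrictMonoOn (fun j : Fin (c.blocksFun i) => oneLine π (c.sizeUpTo i + j)) s := by
    intro s
    simp only [StrictMonoOn, Fin.lt_def, h]
  have hanti : ∀ s : Set (Fin (c.blocksFun i)),
      StrictAntiOn (fun j => π (c.embedding i j)) s ↔
        StrictAntiOn (fun j : Fin (c.blocksFun i) => oneLine π (c.sizeUpTo i + j)) s := by
    intro s
    simp only [StrictAntiOn, Fin.lt_def, h]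
  unfold IsUnimodal IsUnimodalRun
  simp only [hmono, hanti, strictMonoOn_Iic_iff, strictAntiOn_Ici_iff]
  constructor
  · rintro ⟨p, h1, h2⟩
    exact ⟨p, p.2, h1, h2⟩
  · rintro ⟨p, hp, h1, h2⟩
    exact ⟨⟨p, hp⟩, h1, h2⟩

theorem mem_descentSet {n : ℕ} {π : Perm (Fin n)} {q : ℕ} :
    q ∈ descentSet π ↔ ∃ j, q = j + 1 ∧ j + 1 < n ∧ oneLine π (j + 1) < oneLine π j := by
  simp only [descentSet, Finset.mem_filter, Finset.mem_Ico]
  constructor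
  · rintro ⟨hq, a, b, ha, hb, hab⟩
    refine ⟨a, ha.symm, by omega, ?_⟩
    rw [ha, ← hb, oneLine_coe, oneLine_coe]
    exact hab
  · rintro ⟨j, rfl, hj, hlt⟩
    refine ⟨⟨by omega, hj⟩, ⟨j, by omega⟩, ⟨j + 1, hj⟩, rfl, rfl, ?_⟩
    rw [Fin.lt_def, ← oneLine_coe, ← oneLine_coe]
    exact hlt

theorem sizeUpTo_add_lt {n : ℕ} (c : Composition n) (i : Fin c.length) {j : ℕ}
    (hj : j < c.blocksFun i) : c.sizeUpTo i + j < n := by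
  rw [← c.coe_embedding i ⟨j, hj⟩]
  exact Fin.is_lt _

/-- The descents that are not partial sums are the descents inside of the segments. -/
theorem card_descentSet_sdiff {n : ℕ} (c : Composition n) (π : Perm (Fin n)) :
    (descentSet π \ partialSums c).card = ∑ i : Fin c.length,
      ((Finset.range (c.blocksFun i - 1)).filter fun j =>
        oneLine π (c.sizeUpTo i + j + 1) < oneLine π (c.sizeUpTo i + j)).card := by
  rw [← Finset.card_sigma]
  symm
  refine Finset.card_bij (fun p _ => c.sizeUpTo p.1 + p.2 + 1) ?_ ?_ ?_
  · rintro ⟨i, j⟩ hij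
    simp only [Finset.mem_sigma, Finset.mem_univ, true_and, Finset.mem_filter, Finset.mem_range]
      at hij
    obtain ⟨hj, hlt⟩ := hij
    refine Finset.mem_sdiff.2 ⟨mem_descentSet.2 ⟨_, rfl, ?_, hlt⟩, ?_⟩
    · exact sizeUpTo_add_lt c i (j := j + 1) (by omega)
    · intro h
      obtain ⟨k, -, hk⟩ := Finset.mem_image.1 h
      have hs := c.sizeUpTo_succ' i
      dsimp only at hk
      rcases Nat.lt_or_ge (i : ℕ) k with hik | hik
      · have := c.monotone_sizeUpTo (show (i : ℕ) + 1 ≤ k from hik)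
        omega
      · have := c.monotone_sizeUpTo hik
        omega
  · rintro ⟨i, j⟩ hij ⟨i', j'⟩ hij' heq
    simp only [Finset.mem_sigma, Finset.mem_univ, true_and, Finset.mem_filter, Finset.mem_range]
      at hij hij'
    have h1 : j < c.blocksFun i := by omega
    have h2 : j' < c.blocksFun i' := by omega
    have h3 : c.embedding i ⟨j, h1⟩ = c.embedding i' ⟨j', h2⟩ := by
      apply Fin.ext
      rw [c.coe_embedding, c.coe_embedding]
      exact Nat.succ_injective heq
    have h4 : i = i' := by
      rw [← c.index_embedding i ⟨j, h1⟩, h3, c.index_embedding]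
    subst h4
    have h5 := (c.embedding i).injective h3
    simp only [Fin.mk.injEq] at h5
    rw [h5]
  · intro q hq
    obtain ⟨hq1, hq2⟩ := Finset.mem_sdiff.1 hq
    obtain ⟨a, rfl, ha, hlt⟩ := mem_descentSet.1 hq1
    set a' : Fin n := ⟨a, by omega⟩
    have h1 : c.sizeUpTo (c.index a') + c.invEmbedding a' = a := by
      rw [← c.coe_embedding, c.embedding_comp_inv]
    have h2 := (c.invEmbedding a').2
    refine ⟨⟨c.index a', c.invEmbedding a'⟩, ?_, by rw [h1]⟩
    simp only [Finset.mem_sigma, Finset.mem_univ, true_and, Finset.mem_filter, Finset.mem_range]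
    rw [h1]
    refine ⟨?_, hlt⟩
    -- If `a` were the last position of its segment, the descent `a + 1` would be a partial sum.
    by_contra hend
    apply hq2
    refine Finset.mem_image.2 ⟨(c.index a' : ℕ) + 1, Finset.mem_Icc.2 ⟨by omega, (c.index a').2⟩, ?_⟩
    rw [c.sizeUpTo_succ']
    omega

open Classical in
theorem wordWeight_oneLine {n : ℕ} (c : Composition n) (π : Perm (Fin n)) :
    wordWeight (oneLine π) (c.blocks.map fun m => (true, m)) 0 =
      if IsCompUnimodal c π then (-1) ^ (descentSet π \ partialSums c).card else 0 := by
  have h : ∀ i : Fin c.length, blockWeight (oneLine π) (c.sizeUpTo i) (true, c.blocksFun i) =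
      if IsUnimodal (fun j : Fin (c.blocksFun i) => π (c.embedding i j)) then
        (-1) ^ ((Finset.range (c.blocksFun i - 1)).filter fun j =>
          oneLine π (c.sizeUpTo i + j + 1) < oneLine π (c.sizeUpTo i + j)).card else 0 := by
    intro i
    rw [isUnimodal_iff_isUnimodalRun, blockWeight, if_pos rfl, unimodalSign_eq]
    · exact c.one_le_blocksFun i
    · intro j hj heq
      have h1 := sizeUpTo_add_lt c i (j := j) (by omega)
      have h2 := sizeUpTo_add_lt c i hj
      rw [show c.sizeUpTo i + j = (⟨c.sizeUpTo i + j, h1⟩ : Fin n) from rfl,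
        show ((⟨c.sizeUpTo i + j, h1⟩ : Fin n) : ℕ) + 1 = (⟨c.sizeUpTo i + (j + 1), h2⟩ : Fin n) from
        rfl, oneLine_coe, oneLine_coe] at heq
      have := π.injective (Fin.ext heq)
      simp at this
  rw [wordWeight_composition, card_descentSet_sdiff, ← Finset.prod_pow_eq_pow_sum]
  simp only [h]
  rw [Finset.prod_ite_zero]
  simp only [Finset.mem_univ, true_imp_iff]
  exact if_congr Iff.rfl rfl rfl

/-! ### Evaluation of the signed sum and conclusion. -/

theorem mul_sum_unimodalCycles {n : ℕ} (hn : 1 ≤ n) (c : Composition n) :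
    (n : ℚ) * ((∑ π ∈ unimodalCycles c, (-1 : ℤ) ^ (descentSet π \ partialSums c).card : ℤ) : ℚ) =
      ∑ d ∈ n.divisors, (ArithmeticFunction.moebius d : ℚ) * ((n / d).factorial *
        (c.blocks.map fun m => if m = d then (d : ℚ) else 0).prod) := by
  classical
  have : NeZero n := ⟨by omega⟩
  have key := sum_wordWeight (n := n) (c.blocks.map fun m => (true, m))
    (by
      intro p hp
      obtain ⟨m, hm, rfl⟩ := List.mem_map.1 hp
      exact c.blocks_pos hm)
    (by simp [Function.comp_def])
  simp only [wordWeight_oneLine, List.map_map] at key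
  rw [unimodalCycles, ← Finset.filter_filter, Finset.sum_filter]
  push_cast at key ⊢
  exact key

/-- Only the divisor `d` survives, with the term `μ d * k! * d ^ k`, which is then divided by `n = k
* d`. -/
theorem sum_unimodalCycles_of_replicate {n : ℕ} (hn : 1 ≤ n) (c : Composition n) {d k : ℕ}
    (hc : c.blocks = List.replicate k d) :
    ∑ π ∈ unimodalCycles c, (-1 : ℤ) ^ (descentSet π \ partialSums c).card =
      ((k - 1).factorial : ℤ) * (d : ℤ) ^ (k - 1) * ArithmeticFunction.moebius d := by
  have hsum : k * d = n := by
    have := c.blocks_sum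
    rw [hc] at this
    simpa using this
  have hd : 0 < d := Nat.pos_of_ne_zero (by rintro rfl; omega)
  have hk : 0 < k := Nat.pos_of_ne_zero (by rintro rfl; omega)
  have hnd : n / d = k := by rw [← hsum, Nat.mul_div_cancel _ hd]
  have hnq : (n : ℚ) = k * d := by rw [← hsum, Nat.cast_mul]
  have key := mul_sum_unimodalCycles hn c
  rw [hc, Finset.sum_eq_single d] at key
  · rw [hnd, hnq] at key
    simp only [List.map_replicate, if_true, List.prod_replicate] at key
    obtain ⟨k, rfl⟩ := Nat.exists_eq_succ_of_ne_zero hk.ne'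
    have hd' : (d : ℚ) ≠ 0 := by exact_mod_cast hd.ne'
    have hk' : (k : ℚ) + 1 ≠ 0 := by exact_mod_cast k.succ_ne_zero
    rw [← Int.cast_inj (α := ℚ)]
    refine mul_left_cancel₀ (mul_ne_zero hk' hd') ?_
    simp only [Nat.succ_eq_add_one, Nat.add_sub_cancel, Nat.factorial_succ] at key ⊢
    push_cast at key ⊢
    rw [key]
    ring
  · intro e _ hne
    simp [hk.ne', hne.symm]
  · intro h
    exact absurd (Nat.mem_divisors.2 ⟨Dvd.intro_left k hsum, by omega⟩) h

theorem sum_unimodalCycles_of_ne {n : ℕ} (hn : 1 ≤ n) (c : Composition n)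
    (hc : ¬ ∃ d k : ℕ, c.blocks = List.replicate k d) :
    ∑ π ∈ unimodalCycles c, (-1 : ℤ) ^ (descentSet π \ partialSums c).card = 0 := by
  have key := mul_sum_unimodalCycles hn c
  have hzero : ∀ d : ℕ, (c.blocks.map fun m => if m = d then (d : ℚ) else 0).prod = 0 := by
    intro d
    rw [List.prod_eq_zero]
    rw [List.mem_map]
    by_contra h
    push Not at h
    refine hc ⟨d, c.blocks.length, List.eq_replicate_iff.2 ⟨rfl, fun m hm => ?_⟩⟩
    by_contra hmd
    exact h m hm (if_neg hmd)
  simp only [hzero, mul_zero, Finset.sum_const_zero] at key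
  have hn' : (n : ℚ) ≠ 0 := by exact_mod_cast (by omega : n ≠ 0)
  exact Int.cast_eq_zero.1 ((mul_eq_zero.1 key).resolve_left hn')

end UnimodalCycles

theorem theorem1 (n : ℕ) (hn : 1 ≤ n)
    (g : Equiv.Perm (Fin n)) (hg : UnimodalCycles.IsFullCycle g)
    (ψ : Subgroup.zpowers g →* ℂˣ) (hψ : Function.Injective ψ)
    (c : Composition n) :
    (∀ τ : Equiv.Perm (Fin n), τ.partition.parts = (c.blocks : Multiset ℕ) →
      UnimodalCycles.inducedCharacter (Subgroup.zpowers g) ψ τ =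
        ((∑ π ∈ UnimodalCycles.unimodalCycles c,
          (-1 : ℤ) ^ (UnimodalCycles.descentSet π \ UnimodalCycles.partialSums c).card : ℤ) : ℂ)) ∧
    (∀ d k : ℕ, c.blocks = List.replicate k d →
      ∑ π ∈ UnimodalCycles.unimodalCycles c,
          (-1 : ℤ) ^ (UnimodalCycles.descentSet π \ UnimodalCycles.partialSums c).card =
        ((k - 1).factorial : ℤ) * (d : ℤ) ^ (k - 1) * ArithmeticFunction.moebius d) ∧
    ((¬ ∃ d k : ℕ, c.blocks = List.replicate k d) →
      ∑ π ∈ UnimodalCycles.unimodalCycles c,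
          (-1 : ℤ) ^ (UnimodalCycles.descentSet π \ UnimodalCycles.partialSums c).card = 0) := by
  refine ⟨fun τ hτ => ?_, fun d k hc => UnimodalCycles.sum_unimodalCycles_of_replicate hn c hc,
    UnimodalCycles.sum_unimodalCycles_of_ne hn c⟩
  by_cases h : ∃ d k : ℕ, c.blocks = List.replicate k d
  · obtain ⟨d, k, hc⟩ := h
    rw [UnimodalCycles.sum_unimodalCycles_of_replicate hn c hc,
      UnimodalCycles.inducedCharacter_of_replicate hn hg ψ hψ τ (d := d) (k := k) (by
        rw [hτ, hc, Multiset.coe_replicate])]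
    push_cast
    rfl
  · rw [UnimodalCycles.sum_unimodalCycles_of_ne hn c h,
      UnimodalCycles.inducedCharacter_of_ne hg ψ τ, Int.cast_zero]
    intro k d hkd
    -- The cycle type gives the parts only up to order, but a constant list is its only
    -- rearrangement.
    rw [hτ, ← Multiset.coe_replicate, Multiset.coe_eq_coe] at hkd
    exact h ⟨d, k, List.perm_replicate.1 hkd⟩
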